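/- Let $F^0\colon\mathbb{C}\to\mathbb{C}$ be a zero-mean Gaussian Weyl--Heisenberg function (GWHF) with twisted kernel $H\colon\mathbb{C}\to\mathbb{C}$. That is, $F^0$ is a random function such that for all $z_1,\dots,z_n\in\mathbb{C}$ the vector $(F^0(z_1),\dots,F^0(z_n))$ is a circularly symmetric complex Gaussian vector with mean zero, and $$\mathbb{E}\big[F^0(z)\overline{F^0(w)}\big]=H(z-w)\,e^{i\,\mathrm{Im}(z\bar w)},\qquad z,w\in\mathbb{C};$$ moreover $F^0$ is almost surely $C^2$ in the real sense, $H$ is $C^6$ in the real sense, $H(0)=1$, and $|H(z)|<1$ for $z\neq 0$. Let $\partial=\frac12(\partial_x-i\partial_y)$ and $\bar\partial=\frac12(\partial_x+i\partial_y)$. Suppose that there are constants $a,b,c\in\mathbb{C}$, not all zero, such that almost surely $$aF^0(0)=b\,\partial F^0(0)+c\,\bar\partial F^0(0).$$ Then $|c|^2-|b|^2>0$, and $$F^0(z)=e^{[-z(\bar a c+a\bar b)+\bar z(\bar a b+a\bar c)]/(|c|^2-|b|^2)}\cdot F^{GEF}(R(z)),\qquad z\in\mathbb{C},$$ where $$R(z)=(|c|^2-|b|^2)^{-1/2}(cz-b\bar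 z)$$ is an invertible $\mathbb{R}$-linear map of $\mathbb{C}$ that is symplectic, i.e. $\mathrm{Im}(R(z)\overline{R(w)})=\mathrm{Im}(z\bar w)$ for all $z,w\in\mathbb{C}$, and $F^{GEF}$ is a zero-mean GWHF (on the same probability space) with twisted kernel $H^{GEF}(z)=e^{-|z|^2/2}$. -/

import Mathlib

open MeasureTheory ProbabilityTheory Complex
open scoped ComplexConjugate

noncomputable section

/-- The Wirtinger derivative `∂f = (∂ₓ f - i ∂_y f) / 2`. -/
def wirtinger (f : ℂ → ℂ) (z : ℂ) : ℂ :=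
  (fderiv ℝ f z 1 - I * fderiv ℝ f z I) / 2

/-- The Wirtinger derivative `∂̄f = (∂ₓ f + i ∂_y f) / 2`. -/
def wirtingerBar (f : ℂ → ℂ) (z : ℂ) : ℂ :=
  (fderiv ℝ f z 1 + I * fderiv ℝ f z I) / 2

/-- `F` is a zero-mean Gaussian Weyl-Heisenberg function (GWHF) with twisted kernel `H`: a circularly
symmetric complex Gaussian random field on `ℂ`, almost surely `C²` in the real sense, with covariance
`𝔼[F(z) conj(F(w))] = H(z - w) exp(i Im(z conj w))`, where `H` is `C⁶` in the real sense, `H(0) = 1` and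
`|H(z)| < 1` for `z ≠ 0`. -/
structure IsZeroMeanGWHF {Ω : Type*} [MeasurableSpace Ω] (P : Measure Ω)
    (H : ℂ → ℂ) (F : ℂ → Ω → ℂ) : Prop where
  /-- All finite-dimensional vectors are (possibly degenerate) Gaussian vectors over `ℝ`. -/
  gaussian : IsGaussianProcess F P
  /-- All finite-dimensional vectors have a law that is invariant under multiplication by a unimodular
  constant. -/
  circular : ∀ (s : Finset ℂ) (u : ℂ), ‖u‖ = 1 →
    P.map (fun ω (z : s) ↦ u * F z ω) = P.map (fun ω (z : s) ↦ F z ω)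
  mean_zero : ∀ z, ∫ ω, F z ω ∂P = 0
  covariance : ∀ z w, ∫ ω, F z ω * conj (F w ω) ∂P = H (z - w) * exp (I * ((z * conj w).im : ℂ))
  sample_contDiff : ∀ᵐ ω ∂P, ContDiff ℝ 2 (fun z ↦ F z ω)
  kernel_contDiff : ContDiff ℝ 6 H
  kernel_zero : H 0 = 1
  kernel_norm_lt_one : ∀ z, z ≠ 0 → ‖H z‖ < 1

/-- The twisted kernel `exp(-|z|² / 2)` of the weighted Gaussian entire function. -/
def kernelGEF (z : ℂ) : ℂ := exp (-((‖z‖ ^ 2 / 2 : ℝ) : ℂ))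

end

/-! Pairing the relation at the origin with `conj (F (-u))` turns it into a first-order linear
equation for `H` at `u` (`kernel_relation`). Almost sure limits of Gaussian variables are also `L²`
limits, so the difference quotients of `F` may be replaced by those of the covariance. Since `H (-z)
= conj (H z)`, the conjugate equation holds too, giving a 2×2 system for `∂H`, `∂̄H` with
determinant `|b|² - |c|²`. A zero determinant forces `a = b = c = 0`. Otherwise the system
integrates along rays to a unimodular character times a real Gaussian in `c z - b conj z`
(`kernel_eq_exp`), and `|H| < 1` fixes the sign of `|c|² - |b|²`. Hence `H` is the GEF kernel
composed with `R`, times a character; undoing both on the field itself defines `F^GEF`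
(`modulate_comp`). -/

open Filter Topology in
/-- Centred real Gaussian variables that tend to zero almost surely tend to zero in `L²`. -/
lemma tendsto_integral_sq_of_hasGaussianLaw {Ω ι : Type*} [MeasurableSpace Ω]
    {P : Measure Ω} [IsProbabilityMeasure P] {l : Filter ι} [l.IsCountablyGenerated]
    {X : ι → Ω → ℝ} (hX : ∀ i, HasGaussianLaw (X i) P) (hmean : ∀ i, ∫ ω, X i ω ∂P = 0)
    (hlim : ∀ᵐ ω ∂P, Tendsto (fun i ↦ X i ω) l (𝓝 0)) :
    Tendsto (fun i ↦ ∫ ω, X i ω ^ 2 ∂P) l (𝓝 0) := by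
  -- The characteristic function at 1 determines the variance and has a bounded integrand, so
  -- dominated convergence needs no moment bound.
  have hchar : ∀ i, ∫ ω, exp (X i ω * I) ∂P = (Real.exp (-(∫ ω, X i ω ^ 2 ∂P) / 2) : ℂ) := by
    intro i
    have h := (hX i).charFun_map_eq 1
    rw [charFun_apply, integral_map (hX i).aemeasurable (by fun_prop)] at h
    have hv : Var[X i; P] = ∫ ω, X i ω ^ 2 ∂P :=
      variance_of_integral_eq_zero (hX i).aemeasurable (hmean i)
    simp only [RCLike.inner_apply, conj_trivial, mul_one, hmean, hv, one_mul] at h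
    rw [h]
    push_cast
    congr 1
    ring
  have h1 : Tendsto (fun i ↦ ∫ ω, exp (X i ω * I) ∂P) l (𝓝 (∫ _, (1 : ℂ) ∂P)) := by
    refine tendsto_integral_filter_of_dominated_convergence (fun _ ↦ 1) ?_ ?_ (by simp) ?_
    · refine .of_forall fun i ↦ ?_
      have := (hX i).aemeasurable
      exact (by fun_prop : AEMeasurable (fun ω ↦ exp (X i ω * I)) P).aestronglyMeasurable
    · exact .of_forall fun i ↦ .of_forall fun ω ↦ by simp [norm_exp_ofReal_mul_I]
    · filter_upwards [hlim] with ω h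
      have : Continuous fun x : ℝ ↦ exp (x * I) := by fun_prop
      simpa [Function.comp_def] using (this.tendsto 0).comp h
  simp only [hchar, integral_const, probReal_univ, one_smul] at h1
  have h2 := (continuous_re.tendsto _).comp h1
  simp only [Function.comp_def, ofReal_re, one_re] at h2
  have h3 := ((Real.continuousAt_log one_ne_zero).tendsto.comp h2).const_mul (-2)
  simp only [Function.comp_def, Real.log_exp, Real.log_one, mul_zero] at h3
  refine h3.congr fun i ↦ by ring

open Filter Topology in
/-- Centred complex Gaussian variables that tend to zero almost surely tend to zero weakly
in `L²`. -/
lemma tendsto_integral_mul_conj_of_hasGaussianLaw {Ω ι : Type*} [MeasurableSpace Ω]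
    {P : Measure Ω} [IsProbabilityMeasure P] {l : Filter ι} [l.IsCountablyGenerated]
    {X : ι → Ω → ℂ} (hX : ∀ i, HasGaussianLaw (X i) P) (hmean : ∀ i, ∫ ω, X i ω ∂P = 0)
    (hlim : ∀ᵐ ω ∂P, Tendsto (fun i ↦ X i ω) l (𝓝 0)) {Y : Ω → ℂ} (hY : MemLp Y 2 P) :
    Tendsto (fun i ↦ ∫ ω, X i ω * conj (Y ω) ∂P) l (𝓝 0) := by
  have hre : Tendsto (fun i ↦ ∫ ω, (X i ω).re ^ 2 ∂P) l (𝓝 0) := by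
    refine tendsto_integral_sq_of_hasGaussianLaw (fun i ↦ (hX i).map_fun reCLM) ?_ ?_
    · intro i
      have := reCLM.integral_comp_comm (hX i).integrable
      simpa [hmean i] using this
    · filter_upwards [hlim] with ω h
      simpa [Function.comp_def] using (continuous_re.tendsto _).comp h
  have him : Tendsto (fun i ↦ ∫ ω, (X i ω).im ^ 2 ∂P) l (𝓝 0) := by
    refine tendsto_integral_sq_of_hasGaussianLaw (fun i ↦ (hX i).map_fun imCLM) ?_ ?_
    · intro i
      have := imCLM.integral_comp_comm (hX i).integrable
      simpa [hmean i] using this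
    · filter_upwards [hlim] with ω h
      simpa [Function.comp_def] using (continuous_im.tendsto _).comp h
  have hYsq : Integrable (fun ω ↦ ‖Y ω‖ ^ 2) P := hY.integrable_norm_pow (by norm_num)
  -- Weighted Young inequality; a small `s` controls the `Y` term, then the `X` term tends to zero.
  have hbound : ∀ i, ∀ s > 0, ‖∫ ω, X i ω * conj (Y ω) ∂P‖ ≤
      s⁻¹ * (∫ ω, (X i ω).re ^ 2 ∂P + ∫ ω, (X i ω).im ^ 2 ∂P) + s * ∫ ω, ‖Y ω‖ ^ 2 ∂P := by
    intro i s hs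
    have hr : Integrable (fun ω ↦ (X i ω).re ^ 2) P :=
      ((hX i).map_fun reCLM).memLp_two.integrable_sq
    have hi : Integrable (fun ω ↦ (X i ω).im ^ 2) P :=
      ((hX i).map_fun imCLM).memLp_two.integrable_sq
    have hri : Integrable (fun ω ↦ s⁻¹ * ((X i ω).re ^ 2 + (X i ω).im ^ 2)) P :=
      (hr.add hi).const_mul _
    rw [← integral_add hr hi, ← integral_const_mul, ← integral_const_mul,
      ← integral_add hri (hYsq.const_mul _)]
    refine norm_integral_le_of_norm_le (hri.add (hYsq.const_mul _)) ?_
    refine .of_forall fun ω ↦ ?_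
    have hn : (X i ω).re ^ 2 + (X i ω).im ^ 2 = ‖X i ω‖ ^ 2 := by
      rw [Complex.sq_norm, normSq_apply]; ring
    simp only [norm_mul, RCLike.norm_conj, hn]
    have h := two_mul_le_add_sq ‖X i ω‖ (s * ‖Y ω‖)
    have h' : ‖X i ω‖ * ‖Y ω‖ ≤ s⁻¹ * (‖X i ω‖ ^ 2 + (s * ‖Y ω‖) ^ 2) := by
      rw [le_inv_mul_iff₀ hs]
      nlinarith [mul_nonneg hs.le (mul_nonneg (norm_nonneg (X i ω)) (norm_nonneg (Y ω)))]
    refine h'.trans_eq ?_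
    field_simp
  rw [tendsto_zero_iff_norm_tendsto_zero, Metric.tendsto_nhds]
  intro ε hε
  set C := ∫ ω, ‖Y ω‖ ^ 2 ∂P with hC
  have hC0 : 0 ≤ C := integral_nonneg fun ω ↦ by positivity
  set s := ε / (2 * (C + 1)) with hs
  have hs0 : 0 < s := by positivity
  have hsC : s * C < ε := by
    rw [hs, div_mul_eq_mul_div, div_lt_iff₀ (by positivity)]
    nlinarith
  have hlim' := (((hre.add him).const_mul s⁻¹).add_const (s * C))
  simp only [add_zero, mul_zero, zero_add] at hlim'
  filter_upwards [hlim'.eventually_lt_const hsC] with i hi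
  simpa using (hbound i s hs0).trans_lt hi

lemma fderiv_eq_wirtinger_add_wirtingerBar (f : ℂ → ℂ) (z h : ℂ) :
    fderiv ℝ f z h = wirtinger f z * h + wirtingerBar f z * conj h := by
  have h1 : fderiv ℝ f z h = h.re * fderiv ℝ f z 1 + h.im * fderiv ℝ f z I := by
    conv_lhs => rw [show h = h.re • (1 : ℂ) + h.im • I by simp]
    rw [map_add, map_smul, map_smul, real_smul, real_smul]
  have h2 : conj h = h.re - h.im * I := by
    apply Complex.ext <;> simp
  have h3 : h = h.re + h.im * I := (re_add_im h).symm
  generalize h.re = x at *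
  generalize h.im = y at *
  rw [h1, h2, h3, wirtinger, wirtingerBar]
  linear_combination (y * fderiv ℝ f z I) * I_sq

/-! ### Covariance identities, changes of variable and the equations for the kernel. -/

namespace IsZeroMeanGWHF

variable {Ω : Type*} [MeasurableSpace Ω] {P : Measure Ω} {H : ℂ → ℂ} {F : ℂ → Ω → ℂ}

lemma memLp_two (hF : IsZeroMeanGWHF P H F) (z : ℂ) : MemLp (F z) 2 P :=
  (hF.gaussian.hasGaussianLaw_eval z).memLp_two

lemma integrable_mul_conj (hF : IsZeroMeanGWHF P H F) (z w : ℂ) :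
    Integrable (fun ω ↦ F z ω * conj (F w ω)) P :=
  (hF.memLp_two z).integrable_mul (hF.memLp_two w).star

/-- The twisted kernel is Hermitian. -/
lemma kernel_neg (hF : IsZeroMeanGWHF P H F) (z : ℂ) : H (-z) = conj (H z) := by
  have h1 := hF.covariance z 0
  have h2 := hF.covariance 0 z
  simp only [map_zero, mul_zero, zero_im, ofReal_zero, exp_zero, mul_one, sub_zero, zero_mul,
    zero_sub] at h1 h2
  rw [← h1, ← h2, ← integral_conj]
  simp [mul_comm]

lemma differentiable_kernel (hF : IsZeroMeanGWHF P H F) : Differentiable ℝ H :=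
  hF.kernel_contDiff.differentiable (by norm_num)

lemma fderiv_kernel_neg (hF : IsZeroMeanGWHF P H F) (z h : ℂ) :
    fderiv ℝ H (-z) h = -conj (fderiv ℝ H z h) := by
  have h1 : HasFDerivAt (fun w ↦ H (-w)) (-fderiv ℝ H (-z)) z := by
    have := (hF.differentiable_kernel (-z)).hasFDerivAt.comp z (hasFDerivAt_id z).neg
    convert! this using 1
    ext; simp
  have h2 : HasFDerivAt (fun w ↦ conj (H w)) (conjCLE.toContinuousLinearMap ∘L fderiv ℝ H z) z :=
    conjCLE.hasFDerivAt.comp z (hF.differentiable_kernel z).hasFDerivAt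
  simp only [hF.kernel_neg] at h1
  have := congrArg (fun L ↦ L h) (h1.unique h2)
  simp only [neg_apply] at this
  rw [← neg_neg (fderiv ℝ H (-z) h), this]
  simp

lemma hasDerivAt_covariance (hF : IsZeroMeanGWHF P H F) (u h : ℂ) :
    HasDerivAt (fun t : ℝ ↦ H (t * h + u) * exp (I * ((t * h * conj (-u)).im : ℂ)))
      (fderiv ℝ H u h + H u * (I * ((h * conj (-u)).im : ℂ))) 0 := by
  have h1 : HasDerivAt (fun t : ℝ ↦ (t : ℂ) * h + u) h 0 := by
    simpa using (ofRealCLM.hasDerivAt (x := 0)).mul_const h |>.add_const u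
  have h2 : HasDerivAt (fun t : ℝ ↦ H (t * h + u)) (fderiv ℝ H u h) 0 := by
    have := (hF.differentiable_kernel (((0 : ℝ) : ℂ) * h + u)).hasFDerivAt.comp_hasDerivAt 0 h1
    simpa [Function.comp_def] using this
  have h3 : HasDerivAt (fun t : ℝ ↦ exp (I * ((t * h * conj (-u)).im : ℂ)))
      (I * ((h * conj (-u)).im : ℂ)) 0 := by
    have h4 : HasDerivAt (fun t : ℝ ↦ I * ((t : ℂ) * ((h * conj (-u)).im : ℂ)))
        (I * ((h * conj (-u)).im : ℂ)) 0 := by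
      simpa using ((ofRealCLM.hasDerivAt (x := 0)).mul_const ((h * conj (-u)).im : ℂ)).const_mul I
    have h5 := h4.cexp
    simp only [ofReal_zero, zero_mul, mul_zero, exp_zero, one_mul] at h5
    refine h5.congr_of_eventuallyEq (.of_forall fun t ↦ ?_)
    simp only [mul_assoc, im_ofReal_mul, ofReal_mul]
  have h4 := h2.fun_mul h3
  simp only [ofReal_zero, zero_mul, zero_add, zero_im, mul_zero, exp_zero, mul_one] at h4
  exact h4

/-- A real-linear symplectic change of variable together with a modulation by a character turns
a GWHF into a GWHF. -/
lemma modulate_comp (hF : IsZeroMeanGWHF P H F) {G : ℂ → ℂ} (S : ℂ ≃ₗ[ℝ] ℂ)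
    (hS : ∀ z w, (S z * conj (S w)).im = (z * conj w).im) (ℓ : ℂ →ₗ[ℝ] ℝ)
    (hG : ∀ z, G z = exp (ℓ z * I) * H (S z)) :
    IsZeroMeanGWHF P G (fun z ω ↦ exp (ℓ z * I) * F (S z) ω) := by
  have hScont : ContDiff ℝ 6 S := S.toContinuousLinearEquiv.contDiff
  have hχ : ContDiff ℝ 6 fun z ↦ exp (ℓ z * I) := by
    have hl : ContDiff ℝ 6 fun z ↦ (ℓ z : ℂ) :=
      (ofRealCLM.comp (LinearMap.toContinuousLinearMap ℓ)).contDiff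
    exact (hl.mul contDiff_const).cexp
  refine ⟨?_, ?_, ?_, ?_, ?_, ?_, ?_, ?_⟩
  · exact (hF.gaussian.comp_right S).comp_left fun z ↦ ContinuousLinearMap.mul ℝ ℂ (exp (ℓ z * I))
  · intro s u hu
    classical
    -- The new vector is the image under `φ` of the old one indexed by `S(s)`, and `φ` commutes with
    -- multiplication by `u`.
    let φ : (s.image S → ℂ) → s → ℂ := fun x z ↦
      exp (ℓ z * I) * x ⟨S z, Finset.mem_image_of_mem _ z.2⟩
    have hφ : Measurable φ := by fun_prop
    have hm : AEMeasurable (fun ω (z : s.image S) ↦ F z ω) P :=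
      aemeasurable_pi_lambda _ fun z ↦ hF.gaussian.aemeasurable z
    have hm' : AEMeasurable (fun ω (z : s.image S) ↦ u * F z ω) P :=
      aemeasurable_pi_lambda _ fun z ↦ (hF.gaussian.aemeasurable z).const_mul u
    have h := congrArg (Measure.map φ) (hF.circular (s.image S) u hu)
    rw [AEMeasurable.map_map_of_aemeasurable hφ.aemeasurable hm,
      AEMeasurable.map_map_of_aemeasurable hφ.aemeasurable hm'] at h
    convert! h using 2
    ext ω z
    simp only [φ, Function.comp_apply]
    ring
  · intro z
    rw [integral_const_mul, hF.mean_zero, mul_zero]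
  · intro z w
    have h1 : ∀ ω, exp (ℓ z * I) * F (S z) ω * conj (exp (ℓ w * I) * F (S w) ω) =
        exp (ℓ (z - w) * I) * (F (S z) ω * conj (F (S w) ω)) := by
      intro ω
      have : exp (ℓ (z - w) * I) = exp (ℓ z * I) * conj (exp (ℓ w * I)) := by
        rw [← exp_conj, ← exp_add]
        congr 1
        simp
        ring
      rw [this, map_mul]
      ring
    simp only [h1]
    rw [integral_const_mul, hF.covariance, hS, hG, map_sub S]
    ring
  · filter_upwards [hF.sample_contDiff] with ω hω
    exact (hχ.of_le (by norm_num)).mul (hω.comp (hScont.of_le (by norm_num)))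
  · rw [funext hG]
    exact hχ.mul (hF.kernel_contDiff.comp hScont)
  · simp [hG, hF.kernel_zero]
  · intro z hz
    rw [hG, norm_mul, norm_exp_ofReal_mul_I, one_mul]
    exact hF.kernel_norm_lt_one _ (by simpa using hz)

variable [IsProbabilityMeasure P]

open Filter Topology in
/-- A first-order linear relation at the origin gives a first-order equation for the kernel. -/
lemma kernel_relation (hF : IsZeroMeanGWHF P H F) {a b c : ℂ}
    (hrel : ∀ᵐ ω ∂P, a * F 0 ω =
      b * wirtinger (fun z ↦ F z ω) 0 + c * wirtingerBar (fun z ↦ F z ω) 0) (u : ℂ) :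
    b * wirtinger H u + c * wirtingerBar H u = (a + b * conj u / 2 - c * u / 2) * H u := by
  -- With these coefficients `b ∂ + c ∂̄ = p ∂ₓ + q ∂_y`.
  set p := (b + c) / 2 with hp
  set q := I * (c - b) / 2 with hq
  let A : ℝ → Ω → ℂ := fun t ω ↦
    a * F 0 ω - (p * ((t : ℂ)⁻¹ * (F (t * 1) ω - F 0 ω)) + q * ((t : ℂ)⁻¹ * (F (t * I) ω - F 0 ω)))
  have hgauss : ∀ t, HasGaussianLaw (A t) P := by
    intro t
    let s : Finset ℂ := {0, (t : ℂ) * 1, (t : ℂ) * I}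
    let M : ℂ → ℂ →L[ℝ] ℂ := fun α ↦ ContinuousLinearMap.mul ℝ ℂ α
    let pr : (z : ℂ) → z ∈ s → (s → ℂ) →L[ℝ] ℂ := fun z hz ↦
      ContinuousLinearMap.proj (R := ℝ) (φ := fun _ : s ↦ ℂ) ⟨z, hz⟩
    have h0 : (0 : ℂ) ∈ s := by simp [s]
    have h1 : (t : ℂ) * 1 ∈ s := by simp [s]
    have h2 : (t : ℂ) * I ∈ s := by simp [s]
    have := (hF.gaussian.hasGaussianLaw s).map_fun
      (M a ∘L pr 0 h0 - (M p ∘L M (t : ℂ)⁻¹ ∘L (pr _ h1 - pr 0 h0) +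
        M q ∘L M (t : ℂ)⁻¹ ∘L (pr _ h2 - pr 0 h0)))
    exact this
  have hmean : ∀ t, ∫ ω, A t ω ∂P = 0 := by
    intro t
    have hi : ∀ z, Integrable (F z) P := fun z ↦ (hF.gaussian.hasGaussianLaw_eval z).integrable
    have hd : ∀ (α z : ℂ), Integrable (fun ω ↦ α * ((t : ℂ)⁻¹ * (F z ω - F 0 ω))) P := fun α z ↦
      (((hi z).sub (hi 0)).const_mul _).const_mul _
    have he : ∀ (α z : ℂ), ∫ ω, α * ((t : ℂ)⁻¹ * (F z ω - F 0 ω)) ∂P = 0 := fun α z ↦ by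
      rw [integral_const_mul, integral_const_mul, integral_sub (hi _) (hi _), hF.mean_zero,
        hF.mean_zero]
      simp
    have hs : Integrable (fun ω ↦ p * ((t : ℂ)⁻¹ * (F (t * 1) ω - F 0 ω)) +
        q * ((t : ℂ)⁻¹ * (F (t * I) ω - F 0 ω))) P := (hd _ _).add (hd _ _)
    simp only [A]
    rw [integral_sub ((hi 0).const_mul _) hs, integral_add (hd _ _) (hd _ _),
      he, he, integral_const_mul, hF.mean_zero]
    simp
  have hlim : ∀ᵐ ω ∂P, Tendsto (fun t ↦ A t ω) (𝓝[≠] 0) (𝓝 0) := by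
    filter_upwards [hrel, hF.sample_contDiff] with ω hω hdiff
    have hslope : ∀ h : ℂ, Tendsto (fun t : ℝ ↦ (t : ℂ)⁻¹ * (F (t * h) ω - F 0 ω)) (𝓝[≠] 0)
        (𝓝 (fderiv ℝ (fun z ↦ F z ω) 0 h)) := by
      intro h
      have h1 : HasDerivAt (fun t : ℝ ↦ (t : ℂ) * h) h 0 := by
        simpa using (ofRealCLM.hasDerivAt (x := 0)).mul_const h
      have h2 := ((hdiff.differentiable (by norm_num)) (((0 : ℝ) : ℂ) * h)).hasFDerivAt
        |>.comp_hasDerivAt 0 h1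
      simpa using h2.tendsto_slope_zero
    have := (tendsto_const_nhds (x := a * F 0 ω)).sub
      (((hslope 1).const_mul p).add ((hslope I).const_mul q))
    have hz : a * F 0 ω - (p * fderiv ℝ (fun z ↦ F z ω) 0 1 +
        q * fderiv ℝ (fun z ↦ F z ω) 0 I) = 0 := by
      rw [hω, hp, hq, wirtinger, wirtingerBar]
      ring
    rwa [hz] at this
  have hzero := tendsto_integral_mul_conj_of_hasGaussianLaw hgauss hmean hlim (hF.memLp_two (-u))
  let K : ℂ → ℂ := fun z ↦ H (z + u) * exp (I * ((z * conj (-u)).im : ℂ))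
  have hcov : ∀ t, ∫ ω, A t ω * conj (F (-u) ω) ∂P =
      a * K 0 - (p * ((t : ℂ)⁻¹ * (K (t * 1) - K 0)) + q * ((t : ℂ)⁻¹ * (K (t * I) - K 0))) := by
    intro t
    have hi := fun z ↦ hF.integrable_mul_conj z (-u)
    have hK : ∀ z, ∫ ω, F z ω * conj (F (-u) ω) ∂P = K z := fun z ↦ by
      rw [hF.covariance, sub_neg_eq_add]
    have hd : ∀ (α z : ℂ), Integrable (fun ω ↦ α * ((t : ℂ)⁻¹ *
        (F z ω * conj (F (-u) ω) - F 0 ω * conj (F (-u) ω)))) P := fun α z ↦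
      (((hi z).sub (hi 0)).const_mul _).const_mul _
    have he : ∀ (α z : ℂ), ∫ ω, α * ((t : ℂ)⁻¹ *
        (F z ω * conj (F (-u) ω) - F 0 ω * conj (F (-u) ω))) ∂P =
        α * ((t : ℂ)⁻¹ * (K z - K 0)) := fun α z ↦ by
      rw [integral_const_mul, integral_const_mul, integral_sub (hi _) (hi _), hK, hK]
    have hs := (hd p (t * 1)).add (hd q (t * I))
    simp only [Pi.add_def] at hs
    rw [← he, ← he, ← hK 0, ← integral_const_mul, ← integral_add (hd _ _) (hd _ _),
      ← integral_sub ((hi 0).const_mul _) hs]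
    congr 1 with ω
    simp only [A]
    ring
  simp only [hcov] at hzero
  have hslope : ∀ h : ℂ, Tendsto (fun t : ℝ ↦ (t : ℂ)⁻¹ * (K (t * h) - K 0)) (𝓝[≠] 0)
      (𝓝 (fderiv ℝ H u h + H u * (I * ((h * conj (-u)).im : ℂ)))) := fun h ↦ by
    simpa [K] using (hF.hasDerivAt_covariance u h).tendsto_slope_zero
  have huniq := tendsto_nhds_unique hzero ((tendsto_const_nhds (x := a * K 0)).sub
      (((hslope 1).const_mul p).add ((hslope I).const_mul q)))
  have hK0 : K 0 = H u := by simp [K]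
  have hu : conj u = u.re - u.im * I := by
    apply Complex.ext <;> simp
  have h1 : (1 * conj (-u)).im = u.im := by simp
  have hI : (I * conj (-u)).im = -u.re := by simp
  rw [hK0, h1, hI] at huniq
  rw [wirtinger, wirtingerBar, hu]
  rw [hp, hq, ofReal_neg] at huniq
  linear_combination huniq - c / 2 * H u * re_add_im u + (c - b) / 2 * u.re * H u * I_sq

/-- The equation conjugate to `kernel_relation`. -/
lemma kernel_relation_conj (hF : IsZeroMeanGWHF P H F) {a b c : ℂ}
    (hrel : ∀ᵐ ω ∂P, a * F 0 ω =
      b * wirtinger (fun z ↦ F z ω) 0 + c * wirtingerBar (fun z ↦ F z ω) 0) (u : ℂ) :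
    conj c * wirtinger H u + conj b * wirtingerBar H u =
      (-conj a + conj b * u / 2 - conj c * conj u / 2) * H u := by
  have h := congrArg conj (hF.kernel_relation hrel (-u))
  simp only [wirtinger, wirtingerBar, hF.fderiv_kernel_neg, hF.kernel_neg, map_add, map_sub,
    map_mul, map_neg, map_div₀, conj_conj, conj_I, map_ofNat] at h ⊢
  linear_combination -h

end IsZeroMeanGWHF

lemma ofReal_norm_sq_sub_norm_sq (b c : ℂ) :
    ((‖c‖ ^ 2 - ‖b‖ ^ 2 : ℝ) : ℂ) = c * conj c - b * conj b := by
  rw [mul_conj', mul_conj']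
  push_cast
  rfl

/-! ### Solving the first-order system for the kernel. -/

namespace IsZeroMeanGWHF

variable {Ω : Type*} [MeasurableSpace Ω] {P : Measure Ω} [IsProbabilityMeasure P] {H : ℂ → ℂ}
  {F : ℂ → Ω → ℂ} {a b c : ℂ}

lemma norm_sq_sub_norm_sq_ne_zero (hF : IsZeroMeanGWHF P H F)
    (habc : ¬(a = 0 ∧ b = 0 ∧ c = 0))
    (hrel : ∀ᵐ ω ∂P, a * F 0 ω =
      b * wirtinger (fun z ↦ F z ω) 0 + c * wirtingerBar (fun z ↦ F z ω) 0) :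
    ‖c‖ ^ 2 - ‖b‖ ^ 2 ≠ 0 := by
  intro hD
  have hD' : c * conj c = b * conj b := by
    rw [← sub_eq_zero, ← ofReal_norm_sq_sub_norm_sq, hD, ofReal_zero]
  have hne : ∀ᶠ t : ℝ in nhds 0, H (t * 1) ≠ 0 ∧ H (t * I) ≠ 0 := by
    have hcont : ∀ h : ℂ, ∀ᶠ t : ℝ in nhds 0, H (t * h) ≠ 0 := fun h ↦ by
      have : Continuous fun t : ℝ ↦ H (t * h) :=
        hF.kernel_contDiff.continuous.comp (by fun_prop)
      exact this.continuousAt.eventually_ne (by simp [hF.kernel_zero])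
    exact (hcont 1).and (hcont I)
  obtain ⟨t, ⟨ht1, htI⟩, ht0⟩ :=
    ((hne.filter_mono nhdsWithin_le_nhds).and (self_mem_nhdsWithin (s := {(0 : ℝ)}ᶜ))).exists
  have ht0' : (t : ℂ) ≠ 0 := by simpa using ht0
  -- When the determinant vanishes, both derivatives can be eliminated, leaving a real-affine
  -- function of `v` that vanishes wherever `H` does not, in particular near 0.
  have key : ∀ v, H v ≠ 0 →
      a * conj c + conj a * b + b * conj c * conj v - b * conj b * v = 0 := by
    intro v hv
    have h1 := hF.kernel_relation hrel v
    have h2 := hF.kernel_relation_conj hrel v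
    refine (mul_eq_zero.mp ?_).resolve_right hv
    linear_combination b * h2 - conj c * h1 + (wirtingerBar H v + v / 2 * H v) * hD'
  have k0 := key 0 (by simp [hF.kernel_zero])
  have k1 := key _ ht1
  have kI := key _ htI
  simp only [map_zero, map_mul, conj_ofReal, conj_I, mul_zero, mul_one, add_zero, sub_zero] at k0 k1 kI
  have hb : b = 0 := by
    have e1 : b * conj c - b * conj b = 0 := by
      refine (mul_eq_zero.mp ?_).resolve_left ht0'
      linear_combination k1 - k0
    have e2 : b * conj c + b * conj b = 0 := by
      refine (mul_eq_zero.mp ?_).resolve_left (mul_ne_zero ht0' I_ne_zero)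
      linear_combination k0 - kI
    have e3 : b * conj b = 0 := by linear_combination (e2 - e1) / 2
    simpa using e3
  have hc : c = 0 := by simpa [hb] using hD'
  have h0 := hF.kernel_relation hrel 0
  rw [hb, hc, hF.kernel_zero] at h0
  exact habc ⟨by simpa using h0.symm, hb, hc⟩

/-- The kernel is the exponential of an explicit quadratic polynomial. -/
lemma kernel_eq_exp (hF : IsZeroMeanGWHF P H F)
    (hrel : ∀ᵐ ω ∂P, a * F 0 ω =
      b * wirtinger (fun z ↦ F z ω) 0 + c * wirtingerBar (fun z ↦ F z ω) 0)
    (hD : ‖c‖ ^ 2 - ‖b‖ ^ 2 ≠ 0) (v : ℂ) :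
    H v = exp ((-v * (conj a * c + a * conj b) + conj v * (conj a * b + a * conj c)) /
      ((‖c‖ ^ 2 - ‖b‖ ^ 2 : ℝ) : ℂ)) *
        exp (-(‖c * v - b * conj v‖ ^ 2 / (‖c‖ ^ 2 - ‖b‖ ^ 2) / 2 : ℝ)) := by
  set D : ℂ := ((‖c‖ ^ 2 - ‖b‖ ^ 2 : ℝ) : ℂ) with hDdef
  have hD0 : D ≠ 0 := by simpa [hDdef, -ofReal_sub] using hD
  have hDeq : D = c * conj c - b * conj b := ofReal_norm_sq_sub_norm_sq b c
  set A : ℂ := (-v * (conj a * c + a * conj b) + conj v * (conj a * b + a * conj c)) / D with hA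
  set B : ℂ := -((c * v - b * conj v) * (conj c * conj v - conj b * v) / D / 2) with hB
  have hB' : ((-(‖c * v - b * conj v‖ ^ 2 / (‖c‖ ^ 2 - ‖b‖ ^ 2) / 2 : ℝ) : ℝ) : ℂ) = B := by
    rw [hB, hDdef]
    push_cast
    rw [← mul_conj']
    simp
  -- An integrating factor along the ray through `v` avoids a logarithm of `H`, whose nonvanishing
  -- is not yet known.
  have hderiv : ∀ t : ℝ, HasDerivAt (fun t : ℝ ↦ H (t * v) * exp (-(t * A + t ^ 2 * B))) 0 t := by
    intro t
    have hofReal : HasDerivAt (fun t : ℝ ↦ (t : ℂ)) 1 t :=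
      ofRealCLM.hasDerivAt
    have h1 : HasDerivAt (fun t : ℝ ↦ H (t * v)) (fderiv ℝ H (t * v) v) t := by
      have h2 : HasDerivAt (fun t : ℝ ↦ (t : ℂ) * v) v t := by
        simpa using hofReal.mul_const v
      exact (hF.differentiable_kernel (t * v)).hasFDerivAt.comp_hasDerivAt t h2
    have h2 : HasDerivAt (fun t : ℝ ↦ -((t : ℂ) * A + (t : ℂ) ^ 2 * B)) (-(A + 2 * t * B)) t := by
      have := ((hofReal.mul_const A).fun_add ((hofReal.fun_pow 2).mul_const B)).fun_neg
      simpa using this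
    have h3 := h1.fun_mul h2.cexp
    convert! h3 using 1
    have e1 := hF.kernel_relation hrel (t * v)
    have e2 := hF.kernel_relation_conj hrel (t * v)
    rw [map_mul, conj_ofReal] at e1 e2
    have e3 : fderiv ℝ H (t * v) v = H (t * v) * (A + 2 * t * B) := by
      rw [fderiv_eq_wirtinger_add_wirtingerBar, hA, hB]
      field_simp
      rw [hDeq]
      -- Cramer's rule: the two brackets isolate `D ∂H` and `D ∂̄H`.
      linear_combination v * (c * e2 - conj b * e1) + conj v * (conj c * e1 - b * e2)
    rw [e3]
    ring
  have hconst := is_const_of_deriv_eq_zero (fun t ↦ (hderiv t).differentiableAt)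
    (fun t ↦ (hderiv t).deriv) 1 0
  simp only [ofReal_one, one_mul, one_pow, ofReal_zero, zero_mul, hF.kernel_zero, ne_eq,
    OfNat.ofNat_ne_zero, not_false_eq_true, zero_pow, add_zero, neg_zero, exp_zero] at hconst
  rw [← ofReal_neg, hB', ← exp_add]
  rw [exp_neg] at hconst
  field_simp at hconst
  exact hconst

lemma norm_sq_sub_norm_sq_pos (hF : IsZeroMeanGWHF P H F)
    (habc : ¬(a = 0 ∧ b = 0 ∧ c = 0))
    (hrel : ∀ᵐ ω ∂P, a * F 0 ω =
      b * wirtinger (fun z ↦ F z ω) 0 + c * wirtingerBar (fun z ↦ F z ω) 0) :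
    0 < ‖c‖ ^ 2 - ‖b‖ ^ 2 := by
  have hD := hF.norm_sq_sub_norm_sq_ne_zero habc hrel
  by_contra hle
  have hlt := hF.kernel_norm_lt_one 1 one_ne_zero
  rw [hF.kernel_eq_exp hrel hD 1, norm_mul, norm_exp, norm_exp] at hlt
  -- The numerator has the form `conj w - w`, so this factor is unimodular and only the Gaussian
  -- factor affects the norm.
  have h1 : ((-1 * (conj a * c + a * conj b) + conj 1 * (conj a * b + a * conj c)) /
      ((‖c‖ ^ 2 - ‖b‖ ^ 2 : ℝ) : ℂ)).re = 0 := by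
    rw [div_ofReal_re]
    simp
    ring_nf
    simp
  rw [h1, Real.exp_zero, one_mul, ← ofReal_neg, ofReal_re, Real.exp_lt_one_iff] at hlt
  have : ‖c * 1 - b * conj 1‖ ^ 2 / (‖c‖ ^ 2 - ‖b‖ ^ 2) ≤ 0 :=
    div_nonpos_of_nonneg_of_nonpos (by positivity) (not_lt.mp hle)
  linarith

end IsZeroMeanGWHF

/-! ### The symplectic change of variable and the conclusion. -/

/-- The real-linear map `z ↦ c z - b conj z`, rescaled so as to be symplectic. -/
noncomputable def symplecticEquiv (b c : ℂ) (hD : 0 < ‖c‖ ^ 2 - ‖b‖ ^ 2) : ℂ ≃ₗ[ℝ] ℂ where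
  toFun z := ((√(‖c‖ ^ 2 - ‖b‖ ^ 2))⁻¹ : ℝ) * (c * z - b * conj z)
  invFun z := ((√(‖c‖ ^ 2 - ‖b‖ ^ 2))⁻¹ : ℝ) * (conj c * z + b * conj z)
  map_add' z w := by simp only [map_add]; ring
  map_smul' r z := by simp only [real_smul, map_mul, conj_ofReal, RingHom.id_apply]; ring
  left_inv z := by
    have h : (((√(‖c‖ ^ 2 - ‖b‖ ^ 2))⁻¹ : ℝ) : ℂ) ^ 2 * (c * conj c - b * conj b) = 1 := by
      rw [← ofReal_norm_sq_sub_norm_sq, ← ofReal_pow, ← ofReal_mul, inv_pow, Real.sq_sqrt hD.le,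
        inv_mul_cancel₀ hD.ne', ofReal_one]
    simp only [map_mul, map_sub, conj_ofReal, conj_conj]
    linear_combination z * h
  right_inv z := by
    have h : (((√(‖c‖ ^ 2 - ‖b‖ ^ 2))⁻¹ : ℝ) : ℂ) ^ 2 * (c * conj c - b * conj b) = 1 := by
      rw [← ofReal_norm_sq_sub_norm_sq, ← ofReal_pow, ← ofReal_mul, inv_pow, Real.sq_sqrt hD.le,
        inv_mul_cancel₀ hD.ne', ofReal_one]
    simp only [map_mul, map_add, conj_ofReal, conj_conj]
    linear_combination z * h

lemma symplecticEquiv_apply (b c : ℂ) (hD : 0 < ‖c‖ ^ 2 - ‖b‖ ^ 2) (z : ℂ) :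
    symplecticEquiv b c hD z = ((√(‖c‖ ^ 2 - ‖b‖ ^ 2))⁻¹ : ℝ) * (c * z - b * conj z) := rfl

lemma im_symplecticEquiv_mul_conj (b c : ℂ) (hD : 0 < ‖c‖ ^ 2 - ‖b‖ ^ 2) (z w : ℂ) :
    (symplecticEquiv b c hD z * conj (symplecticEquiv b c hD w)).im = (z * conj w).im := by
  set r := (√(‖c‖ ^ 2 - ‖b‖ ^ 2))⁻¹ with hr
  have h : r ^ 2 * (‖c‖ ^ 2 - ‖b‖ ^ 2) = 1 := by
    rw [hr, inv_pow, Real.sq_sqrt hD.le, inv_mul_cancel₀ hD.ne']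
  rw [Complex.sq_norm, Complex.sq_norm, normSq_apply, normSq_apply] at h
  rw [symplecticEquiv_apply, symplecticEquiv_apply, ← hr]
  simp only [map_mul, map_sub, conj_ofReal, conj_conj, mul_im, mul_re, sub_re, sub_im, conj_re,
    conj_im, ofReal_re, ofReal_im]
  linear_combination (z.im * w.re - z.re * w.im) * h

lemma norm_symplecticEquiv_sq (b c : ℂ) (hD : 0 < ‖c‖ ^ 2 - ‖b‖ ^ 2) (z : ℂ) :
    ‖symplecticEquiv b c hD z‖ ^ 2 = ‖c * z - b * conj z‖ ^ 2 / (‖c‖ ^ 2 - ‖b‖ ^ 2) := by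
  rw [symplecticEquiv_apply, norm_mul, mul_pow, norm_real, Real.norm_eq_abs, sq_abs, inv_pow,
    Real.sq_sqrt hD.le, div_eq_inv_mul]

theorem proposition3p5 {Ω : Type*} [MeasurableSpace Ω] (P : Measure Ω) [IsProbabilityMeasure P]
    (H : ℂ → ℂ) (F₀ : ℂ → Ω → ℂ) (hF : IsZeroMeanGWHF P H F₀)
    (a b c : ℂ) (habc : ¬(a = 0 ∧ b = 0 ∧ c = 0))
    (hrel : ∀ᵐ ω ∂P, a * F₀ 0 ω =
      b * wirtinger (fun z ↦ F₀ z ω) 0 + c * wirtingerBar (fun z ↦ F₀ z ω) 0) :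
    0 < ‖c‖ ^ 2 - ‖b‖ ^ 2 ∧
    ∃ R : ℂ ≃ₗ[ℝ] ℂ,
      (∀ z, R z = ((√(‖c‖ ^ 2 - ‖b‖ ^ 2))⁻¹ : ℝ) * (c * z - b * conj z)) ∧
      (∀ z w, (R z * conj (R w)).im = (z * conj w).im) ∧
      ∃ FGEF : ℂ → Ω → ℂ, IsZeroMeanGWHF P kernelGEF FGEF ∧
        ∀ ω z, F₀ z ω =
          exp ((-z * (conj a * c + a * conj b) + conj z * (conj a * b + a * conj c)) /
            ((‖c‖ ^ 2 - ‖b‖ ^ 2 : ℝ) : ℂ)) * FGEF (R z) ω := by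
  have hD := hF.norm_sq_sub_norm_sq_pos habc hrel
  set R := symplecticEquiv b c hD with hR
  have hRim := im_symplecticEquiv_mul_conj b c hD
  refine ⟨hD, R, symplecticEquiv_apply b c hD, hRim, ?_⟩
  -- The exponent in the claim is `-i m(z)`; real-linearity of `m` is what makes its removal a
  -- modulation by a character.
  let m : ℂ →ₗ[ℝ] ℝ :=
    ((2 / (‖c‖ ^ 2 - ‖b‖ ^ 2)) • imLm) ∘ₗ (LinearMap.mulLeft ℝ (conj a * c + a * conj b))
  have hm : ∀ z, (-z * (conj a * c + a * conj b) + conj z * (conj a * b + a * conj c)) /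
      ((‖c‖ ^ 2 - ‖b‖ ^ 2 : ℝ) : ℂ) = -(m z * I) := by
    intro z
    have him : (2 * ((conj a * c + a * conj b) * z).im : ℂ) * I =
        (conj a * c + a * conj b) * z - conj ((conj a * c + a * conj b) * z) := by
      rw [sub_conj]
      push_cast
      ring
    have hmz : (m z : ℂ) = 2 * ((conj a * c + a * conj b) * z).im /
        ((‖c‖ ^ 2 - ‖b‖ ^ 2 : ℝ) : ℂ) := by
      simp only [m, LinearMap.comp_apply, LinearMap.smul_apply, LinearMap.mulLeft_apply,
        imLm_coe, smul_eq_mul]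
      push_cast
      ring
    rw [hmz, div_mul_eq_mul_div, him, ← neg_div]
    congr 1
    simp only [map_mul, map_add, conj_conj]
    ring
  refine ⟨fun z ω ↦ exp ((m ∘ₗ R.symm.toLinearMap) z * I) * F₀ (R.symm z) ω, ?_, ?_⟩
  · refine hF.modulate_comp R.symm (fun z w ↦ ?_) _ fun z ↦ ?_
    · rw [← hRim, ← hR, R.apply_symm_apply, R.apply_symm_apply]
    · rw [hF.kernel_eq_exp hrel hD.ne', hm, ← norm_symplecticEquiv_sq b c hD, ← hR,
        R.apply_symm_apply, kernelGEF, ← mul_assoc, ← exp_add]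
      simp
  · intro ω z
    rw [hm, ← mul_assoc, ← exp_add]
    simp
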